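/- Let $r,s\ge 0$ be integers and let $R=[r]\times[s]$ be the product of the chains $[r]=\{1<\dots<r\}$ and $[s]=\{1<\dots<s\}$, with the product order; write $q\lessdot p$ if $p$ covers $q$. On the set $\mathbb R_{>0}^R$ of positive labelings of $R$ consider the following maps, where an empty sum or an empty parallel sum is read as $1$. The birational transfer map $\phi$ is the bijection $\phi(x)_p=x_p\big/\sum_{q\lessdot p}x_q$. The birational toggle $t_p$ at $p\in R$ replaces $x_p$ by $$\Big(\sum_{q\gtrdot p}x_q^{-1}\Big)^{-1}\Big(\sum_{q\lessdot p}x_q\Big)\frac1{x_p}$$ and fixes all other coordinates; it is an involution. Birational rowmotion is the bijection $\rho=t_{\mathcal L^{-1}(1)}\circ\cdots\circ t_{\mathcal L^{-1}(rs)}$, where $\mathcal L:R\to\{1,\dots,rs\}$ is any linear extension of $R$. For an interval $I=[i_1,i_2]\times[j_1,j_2]$ of $R$ and $k\ge0$, let $w_I^{(k)}(x)$ be the sum, over all collections of $k$ pairwise vertex-disjoint upward paths in the Hasse diagram of $I$ whose starting points are $(i_1,j_1),(i_1,j_1+1),\dots,(i_1,j_1+k-1)$ and whose end points are $(i_2,j_2-k+1),\dots,(i_2,j_2)$,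 of the product of the labels $x_p$ of all the vertices $p$ on the paths. (Thus $w_I^{(0)}=1$, and $w_I^{(k)}=0$ for $k>j_2-j_1+1$.) Let $\overline w_I^{(k)}(x)$ be the analogous sum with the two coordinates exchanged, that is, with starting points $(i_1,j_1),\dots,(i_1+k-1,j_1)$ and end points $(i_2-k+1,j_2),\dots,(i_2,j_2)$. Then for every $x\in\mathbb R_{>0}^R$, every linear extension $\mathcal L$ and every $k\ge0$, the following hold. 1. If $1<u\le v\le s$, $I=[r]\times[u,v]$ and $I'=[r]\times[u-1,v-1]$, then $$w_I^{(k)}(x)=w_{I'}^{(k)}\big(\phi\circ\rho^{-1}\circ\phi^{-1}(x)\big).$$ 2. (Reflected statement.) If $1<u\le v\le r$, $I=[u,v]\times[s]$ and $I'=[u-1,v-1]\times[s]$, then $$\overline w_I^{(k)}(x)=\overline w_{I'}^{(k)}\big(\phi\circ\rho^{-1}\circ\phi^{-1}(x)\big)\quad\text{and}\quad w_I^{(k)}(x)=w_{I'}^{(k)}\big(\phi\circ\rho^{-1}\circ\phi^{-1}(x)\big).$$ -/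

import Mathlib

namespace ChainShift

open Classical in
/-- The elements covered by `p`. -/
noncomputable def lowerCovers {P : Type*} [Fintype P] [PartialOrder P] (p : P) : Finset P :=
  Finset.univ.filter (fun q => q ⋖ p)

open Classical in
/-- The elements covering `p`. -/
noncomputable def upperCovers {P : Type*} [Fintype P] [PartialOrder P] (p : P) : Finset P :=
  Finset.univ.filter (fun q => p ⋖ q)

open Classical in
/-- The sum of `x` over `S`, where an empty sum is interpreted as `1`. -/
noncomputable def sumOrOne {P : Type*} (S : Finset P) (x : P → ℝ) : ℝ :=
  if S.Nonempty then ∑ q ∈ S, x q else 1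

open Classical in
/-- The parallel sum of `x` over `S`, where an empty parallel sum is interpreted as `1`. -/
noncomputable def parSumOrOne {P : Type*} (S : Finset P) (x : P → ℝ) : ℝ :=
  if S.Nonempty then (∑ q ∈ S, (x q)⁻¹)⁻¹ else 1

/-- Positive real labelings of `P`. -/
abbrev PosLabeling (P : Type*) : Type _ := {x : P → ℝ // ∀ p, 0 < x p}

theorem sumOrOne_pos {P : Type*} (S : Finset P) (x : P → ℝ) (hx : ∀ p ∈ S, 0 < x p) :
    0 < sumOrOne S x := by
  unfold sumOrOne
  split_ifs with h
  · exact Finset.sum_pos hx h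
  · exact one_pos

theorem parSumOrOne_pos {P : Type*} (S : Finset P) (x : P → ℝ) (hx : ∀ p ∈ S, 0 < x p) :
    0 < parSumOrOne S x := by
  unfold parSumOrOne
  split_ifs with h
  · exact inv_pos.mpr (Finset.sum_pos (fun q hq => inv_pos.mpr (hx q hq)) h)
  · exact one_pos

theorem sumOrOne_congr {P : Type*} (S : Finset P) (x y : P → ℝ) (h : ∀ p ∈ S, x p = y p) :
    sumOrOne S x = sumOrOne S y := by
  unfold sumOrOne
  rw [Finset.sum_congr rfl h]

theorem parSumOrOne_congr {P : Type*} (S : Finset P) (x y : P → ℝ) (h : ∀ p ∈ S, x p = y p) :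
    parSumOrOne S x = parSumOrOne S y := by
  unfold parSumOrOne
  rw [Finset.sum_congr rfl (fun q hq => by rw [h q hq])]

/-- The value which the toggle at `p` puts at `p`. -/
noncomputable def toggleValue {P : Type*} [Fintype P] [PartialOrder P] (p : P) (x : P → ℝ) : ℝ :=
  parSumOrOne (upperCovers p) x * sumOrOne (lowerCovers p) x * (1 / x p)

open Classical in
/-- The toggle at `p`, as a map on positive labelings: it changes the `p`th coordinate only. -/
noncomputable def toggleFun {P : Type*} [Fintype P] [PartialOrder P] (p : P)
    (x : PosLabeling P) : PosLabeling P :=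
  ⟨Function.update x.1 p (toggleValue p x.1), fun q => by
    by_cases h : q = p
    · subst h
      rw [Function.update_self]
      exact mul_pos (mul_pos (parSumOrOne_pos _ _ fun q _ => x.2 q)
        (sumOrOne_pos _ _ fun q _ => x.2 q)) (one_div_pos.mpr (x.2 _))
    · rw [Function.update_of_ne h]
      exact x.2 q⟩

theorem toggleFun_involutive {P : Type*} [Fintype P] [PartialOrder P] (p : P) :
    Function.Involutive (toggleFun p) := by
  classical
  intro x
  apply Subtype.ext
  funext q
  by_cases h : q = p
  · subst h
    have h1 : parSumOrOne (upperCovers q) (toggleFun q x).1 = parSumOrOne (upperCovers q) x.1 := by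
      apply parSumOrOne_congr
      intro a ha
      have : a ≠ q := by
        rintro rfl
        simp [upperCovers] at ha
      simp [toggleFun, Function.update_of_ne this]
    have h2 : sumOrOne (lowerCovers q) (toggleFun q x).1 = sumOrOne (lowerCovers q) x.1 := by
      apply sumOrOne_congr
      intro a ha
      have : a ≠ q := by
        rintro rfl
        simp [lowerCovers] at ha
      simp [toggleFun, Function.update_of_ne this]
    have h3 : (toggleFun q x).1 q = toggleValue q x.1 := by simp [toggleFun]
    have h4 : (toggleFun q (toggleFun q x)).1 q = toggleValue q (toggleFun q x).1 := by
      conv_lhs => rw [toggleFun]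
      simp
    rw [h4, toggleValue, h1, h2, h3, toggleValue]
    have a1 := parSumOrOne_pos (upperCovers q) x.1 fun q _ => x.2 q
    have a2 := sumOrOne_pos (lowerCovers q) x.1 fun q _ => x.2 q
    have a3 := x.2 q
    field_simp
  · simp [toggleFun, Function.update_of_ne h]

/-- The birational toggle at `p`, as a permutation of the positive labelings. -/
noncomputable def toggle {P : Type*} [Fintype P] [PartialOrder P] (p : P) :
    Equiv.Perm (PosLabeling P) :=
  (toggleFun_involutive p).toPerm

/-- A bijection `ℓ : P → {0, …, |P| - 1}` is a linear extension if it preserves the order. -/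
def IsLinearExtension {P : Type*} [Fintype P] [PartialOrder P]
    (ℓ : P ≃ Fin (Fintype.card P)) : Prop :=
  ∀ p q, p ≤ q → ℓ p ≤ ℓ q

/-- Birational rowmotion computed along `ℓ`: the product (composition) of the toggles
`t_{ℓ⁻¹(first)} ∘ ⋯ ∘ t_{ℓ⁻¹(last)}`, so the toggle at `ℓ⁻¹(last)` acts first. -/
noncomputable def rowmotion {P : Type*} [Fintype P] [PartialOrder P]
    (ℓ : P ≃ Fin (Fintype.card P)) : Equiv.Perm (PosLabeling P) :=
  ((List.finRange (Fintype.card P)).map fun i => toggle (ℓ.symm i)).prod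

/-- The birational transfer map as a function. -/
noncomputable def transferFun {P : Type*} [Fintype P] [PartialOrder P]
    (x : PosLabeling P) : PosLabeling P :=
  ⟨fun p => x.1 p / sumOrOne (lowerCovers p) x.1,
    fun p => div_pos (x.2 p) (sumOrOne_pos _ _ fun q _ => x.2 q)⟩

theorem transferFun_bijective {P : Type*} [Fintype P] [PartialOrder P] :
    Function.Bijective (transferFun (P := P)) := by
  classical
  have wf : WellFounded ((· < ·) : P → P → Prop) := wellFounded_lt
  constructor
  · intro x y h
    apply Subtype.ext
    funext p
    induction p using wf.induction with
    | _ p ih =>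
      have e := congrFun (congrArg Subtype.val h) p
      simp only [transferFun] at e
      have hs : sumOrOne (lowerCovers p) x.1 = sumOrOne (lowerCovers p) y.1 := by
        apply sumOrOne_congr
        intro q hq
        simp only [lowerCovers, Finset.mem_filter] at hq
        exact ih q hq.2.lt
      rw [hs] at e
      have hp := sumOrOne_pos (lowerCovers p) y.1 fun q _ => y.2 q
      field_simp at e
      exact e
  · intro y
    let F : (p : P) → ((q : P) → q < p → ℝ) → ℝ := fun p g =>
      y.1 p * sumOrOne (lowerCovers p) (fun q => if h : q < p then g q h else 0)
    let z : P → ℝ := wf.fix F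
    have hz : ∀ p, z p = y.1 p * sumOrOne (lowerCovers p) z := by
      intro p
      have e : z p = F p (fun q _ => z q) := wf.fix_eq F p
      rw [e]
      simp only [F]
      congr 1
      apply sumOrOne_congr
      intro q hq
      simp only [lowerCovers, Finset.mem_filter] at hq
      simp [hq.2.lt]
    have hpos : ∀ p, 0 < z p := by
      intro p
      induction p using wf.induction with
      | _ p ih =>
        rw [hz]
        refine mul_pos (y.2 p) (sumOrOne_pos _ _ fun q hq => ?_)
        simp only [lowerCovers, Finset.mem_filter] at hq
        exact ih q hq.2.lt
    refine ⟨⟨z, hpos⟩, ?_⟩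
    apply Subtype.ext
    funext p
    have hp := sumOrOne_pos (lowerCovers p) z fun q _ => hpos q
    simp only [transferFun]
    rw [div_eq_iff hp.ne']
    exact hz p

/-- The birational transfer map `φ`, as a permutation of the positive labelings. -/
noncomputable def transfer {P : Type*} [Fintype P] [PartialOrder P] :
    Equiv.Perm (PosLabeling P) :=
  Equiv.ofBijective transferFun transferFun_bijective

/-- The rectangle poset `[r] × [s]`, with the product order. -/
abbrev Rect (r s : ℕ) : Type := Fin r × Fin s

/-- The coordinates `(i, j)` of an element of the rectangle, counted from `1`. -/
def coords {r s : ℕ} (p : Rect r s) : ℕ × ℕ := (p.1.val + 1, p.2.val + 1)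

/-- The subset `[i₁, i₂] × [j₁, j₂]` of the rectangle (coordinates counted from `1`). -/
def rectInterval (r s i₁ i₂ j₁ j₂ : ℕ) : Finset (Rect r s) :=
  Finset.univ.filter fun p =>
    i₁ ≤ (coords p).1 ∧ (coords p).1 ≤ i₂ ∧ j₁ ≤ (coords p).2 ∧ (coords p).2 ≤ j₂

/-- `C` is the vertex set of an upward path in the Hasse diagram which stays in `I`, starts at
the element with coordinates `a` and ends at the element with coordinates `b`. (A path is
determined by its vertex set.) -/
def IsPath {r s : ℕ} (I : Finset (Rect r s)) (a b : ℕ × ℕ) (C : Finset (Rect r s)) : Prop :=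
  C ⊆ I ∧ ∃ l : List (Rect r s), l.IsChain (· ⋖ ·) ∧ l.toFinset = C ∧
    (∃ p ∈ l.head?, coords p = a) ∧ (∃ q ∈ l.getLast?, coords q = b)

open Classical in
/-- Collections of `k` pairwise vertex-disjoint paths in `I` that start at the `k` points
`S 0, …, S (k-1)` and end at the `k` points `T 0, …, T (k-1)`, in any order; the path starting at
`S a` is `L a`. -/
noncomputable def pathFamilies {r s k : ℕ} (I : Finset (Rect r s)) (S T : Fin k → ℕ × ℕ) :
    Finset (Fin k → Finset (Rect r s)) :=
  Finset.univ.filter fun L =>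
    (∃ σ : Equiv.Perm (Fin k), ∀ a, IsPath I (S a) (T (σ a)) (L a)) ∧
      ∀ a b, a ≠ b → Disjoint (L a) (L b)

/-- The total weight of a finite set of path collections. -/
noncomputable def totalWeight {r s k : ℕ} (F : Finset (Fin k → Finset (Rect r s)))
    (x : Rect r s → ℝ) : ℝ :=
  ∑ L ∈ F, ∏ a, ∏ p ∈ L a, x p

/-- `w_I^{(k)}(x)` for `I = [i₁, i₂] × [j₁, j₂]`: the total weight of the collections of `k`
nonintersecting paths in `I` from `(i₁, j₁), …, (i₁, j₁ + k - 1)` to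
`(i₂, j₂ - k + 1), …, (i₂, j₂)`. -/
noncomputable def chainSum {r s : ℕ} (i₁ i₂ j₁ j₂ k : ℕ) (x : PosLabeling (Rect r s)) : ℝ :=
  totalWeight (pathFamilies (k := k) (rectInterval r s i₁ i₂ j₁ j₂)
    (fun a => (i₁, j₁ + a.val)) (fun b => (i₂, j₂ + 1 + b.val - k))) x.1

/-- The mirror image of `chainSum` under exchanging the two coordinates: the total weight of the
collections of `k` nonintersecting paths in `[i₁, i₂] × [j₁, j₂]` from
`(i₁, j₁), …, (i₁ + k - 1, j₁)` to `(i₂ - k + 1, j₂), …, (i₂, j₂)`. -/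
noncomputable def chainSumRefl {r s : ℕ} (i₁ i₂ j₁ j₂ k : ℕ) (x : PosLabeling (Rect r s)) : ℝ :=
  totalWeight (pathFamilies (k := k) (rectInterval r s i₁ i₂ j₁ j₂)
    (fun a => (i₁ + a.val, j₁)) (fun b => (i₂ + 1 + b.val - k, j₂))) x.1

end ChainShift

/-!
Put `y = φ⁻¹(x)` and `x' = φ(ρ⁻¹(y))`. Along a linear extension every toggle sees final values
above and initial values below (`rowmotion_apply`), so the three labelings are related locally,
and independently of the linear extension: `1 / x_p = ∑_{q ⋖ p} y_q / y_p` and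
`1 / x'_p = ∑_{q ⋗ p} y_p / y_q`, up to the conventions for empty sums
(`transfer_rowmotion_symm`).

By the Lindström–Gessel–Viennot lemma (`det_eq_sum_disjoint`) and planarity
(`SatChain.not_disjoint_of_cross`), both `w_I^{(k)}` and its mirror image are determinants of
single-path sums. For column `j`, let `M_j` be the `r × r` matrix whose entry `(a, b)` is the
product of the labels `x` on `(a, j), …, (b, j)` (zero if `b < a`); its inverse is
`A_j = D_j - N`, where `D_j` is the diagonal matrix of the `1 / x_{ij}` and `N` is the
superdiagonal shift. The single-path sums from column `u` to column `v` are the entries of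
`M_u ⋯ M_v`. With `A'_j` defined in the same way from `x'`, and with the lower unitriangular
matrix `P_j = 1 - ∑_i (y_{ij} / y_{i+1,j}) E_{i+1,i}`, the local relations give
`A_j P_{j-1} = P_j A'_{j-1}`, whence `P_{u-1} (M'_{u-1} ⋯ M'_{v-1}) = (M_u ⋯ M_v) P_v`. This is
`IsShiftPair.conjugation`, proved entrywise by induction along the recursion of the path sums.

The entry `(1, r)` is not affected by the triangular factors (`IsShiftPair.corner_eq`). For
`I = [r] × [u, v]` all the entries of the determinant for `w_I^{(k)}` are of this kind, so they
agree one by one. For `w_I^{(k)}` with `I = [u, v] × [s]` the determinant is, with the two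
coordinates exchanged, the minor of the first `k` rows and last `k` columns of such a matrix,
which is not affected either (`IsShiftPair.det_eq`).
-/

namespace ChainShift

/-! ### Saturated chains -/

/-- `SatChain a b C` says that `C` is the set of elements of a saturated chain
`a = c₀ ⋖ c₁ ⋖ ⋯ ⋖ cₙ = b`. -/
inductive SatChain {α : Type*} [PartialOrder α] [DecidableEq α] (a : α) : α → Finset α → Prop
  | single : SatChain a a {a}
  | snoc {q b : α} {C : Finset α} : SatChain a q C → q ⋖ b → SatChain a b (insert b C)

namespace SatChain

variable {α : Type*} [PartialOrder α] [DecidableEq α] {a b v p q : α} {C D : Finset α}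

theorem left_mem (h : SatChain a b C) : a ∈ C := by
  induction h with
  | single => simp
  | snoc _ _ ih => exact Finset.mem_insert_of_mem ih

theorem right_mem (h : SatChain a b C) : b ∈ C := by
  cases h <;> simp

theorem mem_bounds (h : SatChain a b C) : ∀ p ∈ C, a ≤ p ∧ p ≤ b := by
  induction h with
  | single => simp
  | snoc h hq ih =>
    intro p hp
    rcases Finset.mem_insert.1 hp with rfl | hp
    · exact ⟨(ih _ h.right_mem).1.trans hq.le, le_rfl⟩
    · exact ⟨(ih p hp).1, (ih p hp).2.trans hq.le⟩

theorem le (h : SatChain a b C) : a ≤ b := (h.mem_bounds _ h.right_mem).1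

theorem total (h : SatChain a b C) : ∀ p ∈ C, ∀ q ∈ C, p ≤ q ∨ q ≤ p := by
  induction h with
  | single => simp
  | snoc h hq ih =>
    intro p hp q' hq'
    rcases Finset.mem_insert.1 hp with rfl | hp'
    · exact Or.inr ((h.snoc hq).mem_bounds _ hq').2
    · rcases Finset.mem_insert.1 hq' with rfl | hq''
      · exact Or.inl ((h.snoc hq).mem_bounds _ hp).2
      · exact ih p hp' q' hq''

theorem notMem_of_covBy (h : SatChain a q C) (hq : q ⋖ b) : b ∉ C := fun hb =>
  (h.mem_bounds b hb).2.not_gt hq.lt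

theorem eq_singleton (h : SatChain a b C) (hab : a = b) : C = {a} := by
  subst hab
  ext p
  rw [Finset.mem_singleton]
  constructor
  · exact fun hp => le_antisymm (h.mem_bounds p hp).2 (h.mem_bounds p hp).1
  · rintro rfl
    exact h.left_mem

theorem filter_le [DecidableLE α] (h : SatChain a b C) :
    ∀ v ∈ C, SatChain a v (C.filter (· ≤ v)) := by
  induction h with
  | single =>
    intro v hv
    obtain rfl := Finset.mem_singleton.1 hv
    rw [Finset.filter_true_of_mem (by simp)]
    exact SatChain.single
  | @snoc q b C h hq ih =>
    intro v hv
    rcases Finset.mem_insert.1 hv with rfl | hv'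
    · have : (insert v C).filter (· ≤ v) = insert v C :=
        Finset.filter_true_of_mem fun p hp => ((h.snoc hq).mem_bounds p hp).2
      rw [this]
      exact h.snoc hq
    · rw [Finset.filter_insert, if_neg]
      · exact ih v hv'
      · exact fun hb => ((h.mem_bounds v hv').2.trans_lt hq.lt).not_ge hb

theorem filter_ge [DecidableLE α] (h : SatChain a b C) :
    ∀ v ∈ C, SatChain v b (C.filter (v ≤ ·)) := by
  induction h with
  | single =>
    intro v hv
    obtain rfl := Finset.mem_singleton.1 hv
    rw [Finset.filter_true_of_mem (by simp)]
    exact SatChain.single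
  | @snoc q b C h hq ih =>
    intro v hv
    rcases Finset.mem_insert.1 hv with rfl | hv'
    · have : (insert v C).filter (v ≤ ·) = {v} := by
        ext p
        simp only [Finset.mem_filter, Finset.mem_singleton]
        constructor
        · exact fun hp => le_antisymm ((h.snoc hq).mem_bounds p hp.1).2 hp.2
        · rintro rfl
          exact ⟨hv, le_rfl⟩
      rw [this]
      exact SatChain.single
    · rw [Finset.filter_insert, if_pos ((h.mem_bounds v hv').2.trans hq.le)]
      exact (ih v hv').snoc hq

theorem trans (h : SatChain a v C) (h' : SatChain v b D) : SatChain a b (C ∪ D) := by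
  induction h' with
  | single => rwa [Finset.union_eq_left.2 (Finset.singleton_subset_iff.2 h.right_mem)]
  | snoc _ hq ih =>
    rw [Finset.union_insert]
    exact ih.snoc hq

/-- Two saturated chains through a common element can exchange their parts above it. -/
theorem exchange [DecidableLE α] {a' b' : α} (h : SatChain a b C) (h' : SatChain a' b' D)
    (hv : v ∈ C) (hv' : v ∈ D) :
    SatChain a b' (C.filter (· ≤ v) ∪ D.filter (¬ · ≤ v)) := by
  have : C.filter (· ≤ v) ∪ D.filter (¬ · ≤ v) = C.filter (· ≤ v) ∪ D.filter (v ≤ ·) := by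
    ext p
    simp only [Finset.mem_union, Finset.mem_filter]
    constructor
    · rintro (hp | hp)
      · exact Or.inl hp
      · exact Or.inr ⟨hp.1, (h'.total _ hp.1 _ hv').resolve_left hp.2⟩
    · rintro (hp | hp)
      · exact Or.inl hp
      · by_cases hpv : p ≤ v
        · exact Or.inl ⟨le_antisymm hpv hp.2 ▸ hv, hpv⟩
        · exact Or.inr ⟨hp.1, hpv⟩
  rw [this]
  exact (h.filter_le v hv).trans (h'.filter_ge v hv')

theorem map {β : Type*} [PartialOrder β] [DecidableEq β] (e : α ≃o β) (h : SatChain a b C) :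
    SatChain (e a) (e b) (C.map e.toEquiv.toEmbedding) := by
  induction h with
  | single => simpa using SatChain.single
  | snoc _ hq ih =>
    rw [Finset.map_insert]
    exact ih.snoc ((apply_covBy_apply_iff e).2 hq)

end SatChain

open Classical in
/-- The total weight of the saturated chains from `a` to `b`, the weight of a chain being the
product of the labels on it. -/
noncomputable def satChainSum {α : Type*} [PartialOrder α] [DecidableEq α] [Fintype α] (x : α → ℝ)
    (a b : α) : ℝ :=
  ∑ C : Finset α with SatChain a b C, ∏ p ∈ C, x p

open Classical in
/-- Splitting off the last element of a saturated chain. -/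
theorem satChainSum_eq {α : Type*} [PartialOrder α] [DecidableEq α] [Fintype α] (x : α → ℝ)
    (a b : α) :
    satChainSum x a b =
      x b * ((∑ q ∈ lowerCovers b, satChainSum x a q) + if a = b then 1 else 0) := by
  by_cases hab : a = b
  · subst hab
    have h0 : ∑ q ∈ lowerCovers a, satChainSum x a q = 0 := by
      refine Finset.sum_eq_zero fun q hq => Finset.sum_eq_zero fun C hC => ?_
      simp only [lowerCovers, Finset.mem_filter] at hq hC
      exact absurd hC.2.le hq.2.lt.not_ge
    have h1 : (Finset.univ.filter fun C : Finset α => SatChain a a C) = {{a}} := by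
      ext C
      simp only [Finset.mem_filter, Finset.mem_univ, true_and, Finset.mem_singleton]
      exact ⟨fun h => h.eq_singleton rfl, fun h => h ▸ SatChain.single⟩
    rw [h0, satChainSum, h1]
    simp
  · rw [if_neg hab, add_zero, Finset.mul_sum]
    unfold satChainSum
    simp_rw [Finset.mul_sum]
    rw [Finset.sum_sigma']
    symm
    refine Finset.sum_bij (fun z _ => insert b z.2) ?_ ?_ ?_ ?_
    · rintro ⟨q, C⟩ h
      simp only [lowerCovers, Finset.mem_sigma, Finset.mem_filter, Finset.mem_univ, true_and] at h ⊢
      exact h.2.snoc h.1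
    · rintro ⟨q, C⟩ h ⟨q', C'⟩ h' e
      simp only [lowerCovers, Finset.mem_sigma, Finset.mem_filter, Finset.mem_univ, true_and]
        at h h' e
      have e' : C = C' := by
        rw [← Finset.erase_insert (h.2.notMem_of_covBy h.1), e,
          Finset.erase_insert (h'.2.notMem_of_covBy h'.1)]
      subst e'
      have : q = q' := le_antisymm (h'.2.mem_bounds _ h.2.right_mem).2
        (h.2.mem_bounds _ h'.2.right_mem).2
      subst this
      rfl
    · intro C hC
      simp only [Finset.mem_filter, Finset.mem_univ, true_and] at hC
      cases hC with
      | single => exact absurd rfl hab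
      | @snoc q _ C h hq =>
        exact ⟨⟨q, C⟩, by simp [lowerCovers, hq, h], rfl⟩
    · rintro ⟨q, C⟩ h
      simp only [lowerCovers, Finset.mem_sigma, Finset.mem_filter, Finset.mem_univ, true_and] at h
      rw [Finset.prod_insert (h.2.notMem_of_covBy h.1)]

/-! ### The Lindström–Gessel–Viennot lemma -/

/-- Exchange, according to the permutation `τ`, the parts not below `v` of a family of vertex
sets. -/
def tailSwap {α κ : Type*} [LE α] [DecidableEq α] [DecidableLE α] (v : α) (τ : Equiv.Perm κ)
    (L : κ → Finset α) (c : κ) : Finset α :=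
  (L c).filter (· ≤ v) ∪ (L (τ c)).filter (¬ · ≤ v)

section tailSwap

variable {α κ : Type*} [Preorder α] [DecidableEq α] [DecidableLE α] {v : α} {τ : Equiv.Perm κ}
  {L : κ → Finset α}

theorem mem_tailSwap {c : κ} {p : α} :
    p ∈ tailSwap v τ L c ↔ p ∈ L (if p ≤ v then c else τ c) := by
  by_cases h : p ≤ v <;> simp [tailSwap, h]

theorem tailSwap_tailSwap (hτ : ∀ c, τ (τ c) = c) : tailSwap v τ (tailSwap v τ L) = L := by
  funext c
  ext p
  by_cases h : p ≤ v <;> simp [mem_tailSwap, h, hτ]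

theorem prod_tailSwap [Fintype κ] {R : Type*} [CommMonoid R] (x : α → R) :
    ∏ c, ∏ p ∈ tailSwap v τ L c, x p = ∏ c, ∏ p ∈ L c, x p := by
  have h : ∀ c, ∏ p ∈ tailSwap v τ L c, x p =
      (∏ p ∈ (L c).filter (· ≤ v), x p) * ∏ p ∈ (L (τ c)).filter (¬ · ≤ v), x p := by
    intro c
    refine Finset.prod_union (Finset.disjoint_left.2 fun p hp hp' => ?_)
    exact (Finset.mem_filter.1 hp').2 (Finset.mem_filter.1 hp).2
  simp_rw [h, Finset.prod_mul_distrib]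
  rw [Equiv.prod_comp τ fun c => ∏ p ∈ (L c).filter (¬ · ≤ v), x p, ← Finset.prod_mul_distrib]
  exact Finset.prod_congr rfl fun c _ => Finset.prod_filter_mul_prod_filter_not _ _ _

end tailSwap

/-- The vertices lying on at least two members of a family. -/
def multiPoints {α κ : Type*} (L : κ → Finset α) : Set α :=
  {p | ∃ c d, c ≠ d ∧ p ∈ L c ∧ p ∈ L d}

theorem multiPoints_tailSwap {α κ : Type*} [Preorder α] [DecidableEq α] [DecidableLE α] (v : α)
    (τ : Equiv.Perm κ) (L : κ → Finset α) : multiPoints (tailSwap v τ L) = multiPoints L := by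
  ext p
  simp only [multiPoints, Set.mem_ofPred_eq, mem_tailSwap]
  by_cases h : p ≤ v
  · simp [h]
  · simp only [h, if_false]
    constructor
    · rintro ⟨c, d, hcd, hc, hd⟩
      exact ⟨τ c, τ d, τ.injective.ne hcd, hc, hd⟩
    · rintro ⟨c, d, hcd, hc, hd⟩
      exact ⟨τ.symm c, τ.symm d, τ.symm.injective.ne hcd, by simpa using hc, by simpa using hd⟩

open Classical in
/-- A signed sum over intersecting families vanishes: the families cancel in pairs that differ by
exchanging the tails of two members at a common vertex. -/
theorem sum_sign_intersecting_eq_zero {α κ R : Type*} [PartialOrder α] [Fintype α] [DecidableEq α]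
    [DecidableLE α] [Fintype κ] [DecidableEq κ] [CommRing R] (Q : κ → κ → Finset α → Prop)
    (hQ : ∀ a b a' b' C D v, Q a b C → Q a' b' D → v ∈ C → v ∈ D →
      Q a b' (C.filter (· ≤ v) ∪ D.filter (¬ · ≤ v))) (x : α → R) :
    ∑ z : Equiv.Perm κ × (κ → Finset α) with
      (∀ a, Q a (z.1 a) (z.2 a)) ∧ (multiPoints z.2).Nonempty,
      ((Equiv.Perm.sign z.1 : ℤ) : R) * ∏ a, ∏ p ∈ z.2 a, x p = 0 := by
  rcases isEmpty_or_nonempty α with hα | hα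
  · refine Finset.sum_eq_zero fun z hz => ?_
    obtain ⟨p, -⟩ := (Finset.mem_filter.1 hz).2.2
    exact isEmptyElim p
  rcases isEmpty_or_nonempty κ with hκ | hκ
  · refine Finset.sum_eq_zero fun z hz => ?_
    obtain ⟨p, c, -⟩ := (Finset.mem_filter.1 hz).2.2
    exact isEmptyElim c
  -- The vertex, and the two members through it, are chosen as functions of data which the
  -- exchange of tails leaves unchanged, so that the exchange is an involution.
  let V : (κ → Finset α) → α := fun L => Classical.epsilon fun p => p ∈ multiPoints L
  let W : (κ → Finset α) → κ × κ := fun L =>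
    Classical.epsilon fun w : κ × κ => w.1 ≠ w.2 ∧ V L ∈ L w.1 ∧ V L ∈ L w.2
  let T : (κ → Finset α) → Equiv.Perm κ := fun L => Equiv.swap (W L).1 (W L).2
  let S : (κ → Finset α) → κ → Finset α := fun L => tailSwap (V L) (T L) L
  have hV : ∀ L, (multiPoints L).Nonempty → V L ∈ multiPoints L := fun L h =>
    Classical.epsilon_spec (p := fun p => p ∈ multiPoints L) h
  have hW : ∀ L, (multiPoints L).Nonempty →
      (W L).1 ≠ (W L).2 ∧ V L ∈ L (W L).1 ∧ V L ∈ L (W L).2 := fun L h => by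
    obtain ⟨c, d, hcd⟩ := hV L h
    exact Classical.epsilon_spec
      (p := fun w : κ × κ => w.1 ≠ w.2 ∧ V L ∈ L w.1 ∧ V L ∈ L w.2) ⟨(c, d), hcd⟩
  have hVS : ∀ L, V (S L) = V L := fun L => by
    simp only [V, S, multiPoints_tailSwap]
  have hWS : ∀ L, W (S L) = W L := fun L => by
    have : ∀ c, V L ∈ S L c ↔ V L ∈ L c := fun c => by simp [S, mem_tailSwap]
    simp only [W, hVS, this]
  have hTS : ∀ L, T (S L) = T L := fun L => by simp only [T, hWS]
  have hSS : ∀ L, S (S L) = L := fun L => by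
    have : S (S L) = tailSwap (V (S L)) (T (S L)) (S L) := rfl
    rw [this, hVS, hTS]
    exact tailSwap_tailSwap fun c => Equiv.swap_apply_self _ _ _
  refine Finset.sum_involution (fun z _ => (z.1 * T z.2, S z.2)) ?_ ?_ ?_ ?_
  · rintro ⟨σ, L⟩ h
    simp only [Finset.mem_filter, Finset.mem_univ, true_and] at h
    have : Equiv.Perm.sign (T L) = -1 := Equiv.Perm.sign_swap (hW L h.2).1
    simp [S, prod_tailSwap, this]
  · rintro ⟨σ, L⟩ h - e
    simp only [Finset.mem_filter, Finset.mem_univ, true_and] at h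
    have h1 : σ * T L = σ := congrArg Prod.fst e
    exact (hW L h.2).1 (Equiv.swap_eq_one_iff.1 (mul_eq_left.1 h1))
  · rintro ⟨σ, L⟩ h
    simp only [Finset.mem_filter, Finset.mem_univ, true_and] at h ⊢
    refine ⟨fun c => ?_, ?_⟩
    · obtain ⟨-, h1, h2⟩ := hW L h.2
      rw [Equiv.Perm.mul_apply]
      by_cases hc : V L ∈ L c ∧ V L ∈ L (T L c)
      · exact hQ _ _ _ _ _ _ _ (h.1 c) (h.1 _) hc.1 hc.2
      · have hfix : T L c = c := by
          refine Equiv.swap_apply_of_ne_of_ne ?_ ?_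
          · rintro rfl
            exact hc ⟨h1, by simpa [T] using h2⟩
          · rintro rfl
            exact hc ⟨h2, by simpa [T] using h1⟩
        have : S L c = L c := by
          ext p
          simp [S, mem_tailSwap, hfix]
        rw [hfix, this]
        exact h.1 c
    · simp only [S, multiPoints_tailSwap]
      exact h.2
  · rintro ⟨σ, L⟩ h
    refine Prod.ext ?_ (hSS L)
    change σ * T L * T (S L) = σ
    rw [hTS, mul_assoc, Equiv.swap_mul_self, mul_one]

open Classical in
/-- The Lindström–Gessel–Viennot lemma, for vertex-weighted paths given by their vertex sets;
`Q a b C` means that `C` is a path from the `a`th source to the `b`th sink. When disjoint paths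
can only join sources to sinks in the identical order, no signs are left. -/
theorem det_eq_sum_disjoint {α κ R : Type*} [PartialOrder α] [Fintype α] [DecidableEq α]
    [DecidableLE α] [Fintype κ] [DecidableEq κ] [CommRing R] (Q : κ → κ → Finset α → Prop)
    (hQ : ∀ a b a' b' C D v, Q a b C → Q a' b' D → v ∈ C → v ∈ D →
      Q a b' (C.filter (· ≤ v) ∪ D.filter (¬ · ≤ v)))
    (hplanar : ∀ (σ : Equiv.Perm κ) (L : κ → Finset α), (∀ a, Q a (σ a) (L a)) →
      (∀ a b, a ≠ b → Disjoint (L a) (L b)) → σ = 1) (x : α → R) :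
    Matrix.det (Matrix.of fun a b => ∑ C : Finset α with Q a b C, ∏ p ∈ C, x p) =
      ∑ L : κ → Finset α with
        (∃ σ : Equiv.Perm κ, ∀ a, Q a (σ a) (L a)) ∧ ∀ a b, a ≠ b → Disjoint (L a) (L b),
        ∏ a, ∏ p ∈ L a, x p := by
  have hdisj : ∀ L : κ → Finset α,
      ¬ (multiPoints L).Nonempty ↔ ∀ a b, a ≠ b → Disjoint (L a) (L b) := by
    intro L
    simp only [Set.Nonempty, multiPoints, Set.mem_ofPred_eq, Finset.disjoint_left]
    push Not
    exact ⟨fun h a b hab p => h p a b hab, fun h p a b hab hp => h a b hab hp⟩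
  have hdet : Matrix.det (Matrix.of fun a b => ∑ C : Finset α with Q a b C, ∏ p ∈ C, x p) =
      ∑ z : Equiv.Perm κ × (κ → Finset α) with ∀ a, Q a (z.1 a) (z.2 a),
        ((Equiv.Perm.sign z.1 : ℤ) : R) * ∏ a, ∏ p ∈ z.2 a, x p := by
    rw [← Matrix.det_transpose, Matrix.det_apply', Finset.sum_filter, Fintype.sum_prod_type]
    refine Finset.sum_congr rfl fun σ _ => ?_
    simp only [Matrix.transpose_apply, Matrix.of_apply]
    rw [Finset.prod_univ_sum, Finset.mul_sum, ← Finset.sum_filter]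
    refine Finset.sum_congr ?_ fun _ _ => rfl
    ext L
    simp [Fintype.mem_piFinset]
  rw [hdet, ← Finset.sum_filter_add_sum_filter_not _ fun z => (multiPoints z.2).Nonempty,
    Finset.filter_filter, sum_sign_intersecting_eq_zero Q hQ x, zero_add, Finset.filter_filter]
  refine Finset.sum_bij (fun z _ => z.2) ?_ ?_ ?_ ?_
  · rintro ⟨σ, L⟩ h
    simp only [Finset.mem_filter, Finset.mem_univ, true_and, hdisj] at h ⊢
    exact ⟨⟨σ, h.1⟩, h.2⟩
  · rintro ⟨σ, L⟩ h ⟨σ', L'⟩ h' e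
    simp only [Finset.mem_filter, Finset.mem_univ, true_and, hdisj] at h h'
    exact Prod.ext ((hplanar σ L h.1 h.2).trans (hplanar σ' L' h'.1 h'.2).symm) e
  · intro L h
    simp only [Finset.mem_filter, Finset.mem_univ, true_and] at h
    obtain ⟨⟨σ, hσ⟩, hd⟩ := h
    refine ⟨(σ, L), ?_, rfl⟩
    simp only [Finset.mem_filter, Finset.mem_univ, true_and, hdisj]
    exact ⟨hσ, hd⟩
  · rintro ⟨σ, L⟩ h
    simp only [Finset.mem_filter, Finset.mem_univ, true_and, hdisj] at h
    simp [hplanar σ L h.1 h.2]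

/-! ### Planarity of the rectangle -/

section planar

variable {α β : Type*} [LinearOrder α] [LinearOrder β]

/-- A saturated chain in a product of two chains skips no row. -/
theorem SatChain.exists_fst_eq {p q : α × β} {C : Finset (α × β)} (h : SatChain p q C) :
    ∀ i, p.1 ≤ i → i ≤ q.1 → ∃ z ∈ C, z.1 = i := by
  induction h with
  | single => exact fun i h1 h2 => ⟨p, by simp, le_antisymm h1 h2⟩
  | @snoc z b C h hz ih =>
    intro i h1 h2
    by_cases hi : i ≤ z.1
    · obtain ⟨w, hw, e⟩ := ih i h1 hi
      exact ⟨w, Finset.mem_insert_of_mem hw, e⟩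
    · refine ⟨b, Finset.mem_insert_self _ _, ?_⟩
      rcases Prod.covBy_iff.1 hz with ⟨h3, -⟩ | ⟨-, h3⟩
      · exact (h2.eq_or_lt.resolve_right fun hlt => h3.2 (not_le.1 hi) hlt).symm
      · exact absurd (h2.trans h3.ge) hi

/-- A saturated chain that starts to the left of another one, in the same row, and avoids it
stays to its left. -/
theorem SatChain.snd_lt_of_disjoint {p p' q' z : α × β} {C C' : Finset (α × β)}
    (h' : SatChain p' q' C') (h1 : p.1 = p'.1) (hp : p.2 < p'.2) (h : SatChain p z C) :
    Disjoint C C' → z.1 ≤ q'.1 → ∀ w ∈ C', w.1 = z.1 → z.2 < w.2 := by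
  induction h with
  | single => exact fun _ _ w hw _ => hp.trans_le (h'.mem_bounds w hw).1.2
  | @snoc z b C h hz ih =>
    intro hd hb w hw hwb
    rw [Finset.disjoint_insert_left] at hd
    have ih' := ih hd.2 (hz.le.1.trans hb)
    rcases Prod.covBy_iff.1 hz with ⟨h3, h4⟩ | ⟨h3, h4⟩
    · obtain ⟨w', hw', e⟩ := h'.exists_fst_eq z.1 (h1 ▸ h.le.1) (hz.le.1.trans hb)
      have hlt : w'.1 < w.1 := by rw [e, hwb]; exact h3.lt
      have hle : w' ≤ w := (h'.total _ hw' _ hw).resolve_right fun h5 => h5.1.not_gt hlt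
      rw [← h4]
      exact (ih' w' hw' e).trans_le hle.2
    · have hle : b.2 ≤ w.2 := not_lt.1 fun hlt => h3.2 (ih' w hw (hwb.trans h4.symm)) hlt
      refine hle.lt_of_ne fun e => hd.1 ?_
      rwa [show b = w from Prod.ext hwb.symm e]

/-- Two saturated chains between the same two rows whose end points are in opposite order
intersect. -/
theorem SatChain.not_disjoint_of_cross {p q p' q' : α × β} {C C' : Finset (α × β)}
    (h : SatChain p q C) (h' : SatChain p' q' C') (h1 : p.1 = p'.1) (h2 : q.1 = q'.1)
    (hp : p.2 < p'.2) (hq : q'.2 ≤ q.2) : ¬ Disjoint C C' := fun hd =>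
  (h'.snd_lt_of_disjoint h1 hp h hd h2.le q' h'.right_mem h2.symm).not_ge hq

theorem SatChain.not_disjoint_of_cross' {p q p' q' : α × β} {C C' : Finset (α × β)}
    (h : SatChain p q C) (h' : SatChain p' q' C') (h1 : p.2 = p'.2) (h2 : q.2 = q'.2)
    (hp : p.1 < p'.1) (hq : q'.1 ≤ q.1) : ¬ Disjoint C C' := fun hd =>
  (h.map (OrderIso.prodComm (α := α) (β := β))).not_disjoint_of_cross
    (h'.map (OrderIso.prodComm (α := α) (β := β))) h1 h2 hp hq ((Finset.disjoint_map _).2 hd)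

end planar

/-! ### Paths in the rectangle -/

theorem satChain_of_isChain {α : Type*} [PartialOrder α] [DecidableEq α] (l : List α) :
    ∀ p q, l.IsChain (· ⋖ ·) → p ∈ l.head? → q ∈ l.getLast? → SatChain p q l.toFinset := by
  induction l with
  | nil => simp
  | cons a t ih =>
    intro p q hl hp hq
    obtain rfl : a = p := by simpa using hp
    cases t with
    | nil =>
      obtain rfl : a = q := by simpa using hq
      simpa using SatChain.single
    | cons b t =>
      rw [List.isChain_cons_cons] at hl
      have h := ih b q hl.2 (by simp) (by simpa using hq)
      have h2 := (SatChain.single.snoc hl.1).trans h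
      have e : insert b {a} ∪ (b :: t).toFinset = (a :: b :: t).toFinset := by
        ext
        simp
        tauto
      rwa [e] at h2

theorem SatChain.exists_list {α : Type*} [PartialOrder α] [DecidableEq α] {p q : α}
    {C : Finset α} (h : SatChain p q C) :
    ∃ l : List α, l.IsChain (· ⋖ ·) ∧ l.toFinset = C ∧ p ∈ l.head? ∧ q ∈ l.getLast? := by
  induction h with
  | single => exact ⟨[p], by simp⟩
  | @snoc z b C h hz ih =>
    obtain ⟨l, h1, h2, h3, h4⟩ := ih
    refine ⟨l ++ [b], ?_, ?_, ?_, by simp⟩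
    · refine h1.append (List.isChain_singleton b) fun x hx y hy => ?_
      obtain rfl : b = y := by simpa using hy
      rwa [Option.mem_unique hx h4]
    · ext
      simp [← h2]
    · rw [List.head?_append]
      simp [Option.mem_def.1 h3]

theorem coords_injective {r s : ℕ} : Function.Injective (coords (r := r) (s := s)) := by
  intro p q h
  simp only [coords, Prod.mk.injEq, Nat.add_right_cancel_iff] at h
  exact Prod.ext (Fin.ext h.1) (Fin.ext h.2)

theorem isPath_iff {r s : ℕ} {I : Finset (Rect r s)} {a b : ℕ × ℕ} {C : Finset (Rect r s)} :
    IsPath I a b C ↔ C ⊆ I ∧ ∃ p q, coords p = a ∧ coords q = b ∧ SatChain p q C := by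
  refine and_congr_right fun _ => ⟨?_, ?_⟩
  · rintro ⟨l, h1, rfl, ⟨p, hp, rfl⟩, q, hq, rfl⟩
    exact ⟨p, q, rfl, rfl, satChain_of_isChain l p q h1 hp hq⟩
  · rintro ⟨p, q, rfl, rfl, h⟩
    obtain ⟨l, h1, h2, h3, h4⟩ := h.exists_list
    exact ⟨l, h1, h2, ⟨p, h3, rfl⟩, q, h4, rfl⟩

theorem IsPath.exchange {r s : ℕ} {I : Finset (Rect r s)} {a b a' b' : ℕ × ℕ}
    {C D : Finset (Rect r s)} {v : Rect r s} (h : IsPath I a b C) (h' : IsPath I a' b' D)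
    (hv : v ∈ C) (hv' : v ∈ D) :
    IsPath I a b' (C.filter (· ≤ v) ∪ D.filter (¬ · ≤ v)) := by
  rw [isPath_iff] at h h' ⊢
  obtain ⟨hC, p, _, hp, -, hc⟩ := h
  obtain ⟨hD, _, q, -, hq, hd⟩ := h'
  exact ⟨Finset.union_subset ((Finset.filter_subset _ _).trans hC)
    ((Finset.filter_subset _ _).trans hD), p, q, hp, hq, hc.exchange hd hv hv'⟩

open Classical in
/-- The total weight of the paths in `I` from `a` to `b`. -/
noncomputable def pathSum {r s : ℕ} (I : Finset (Rect r s)) (x : Rect r s → ℝ) (a b : ℕ × ℕ) : ℝ :=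
  ∑ C : Finset (Rect r s) with IsPath I a b C, ∏ p ∈ C, x p

/-- The hypothesis says that two paths whose end points are in opposite order must meet, so that
disjoint paths join the sources to the sinks in order. -/
theorem totalWeight_pathFamilies {r s k : ℕ} (I : Finset (Rect r s)) (S T : Fin k → ℕ × ℕ)
    (x : Rect r s → ℝ)
    (hplanar : ∀ a a' b b' C C', a < a' → b' < b → IsPath I (S a) (T b) C →
      IsPath I (S a') (T b') C' → ¬ Disjoint C C') :
    totalWeight (pathFamilies I S T) x =
      Matrix.det (Matrix.of fun a b => pathSum I x (S a) (T b)) := by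
  classical
  have key := det_eq_sum_disjoint (fun a b C => IsPath I (S a) (T b) C)
    (fun a b a' b' C D v h h' hv hv' => h.exchange h' hv hv') ?_ x
  · refine Eq.trans ?_ (key.symm.trans ?_)
    · refine Finset.sum_congr (Finset.ext fun L => ?_) fun _ _ => rfl
      simp only [pathFamilies, Finset.mem_filter]
    · congr 1
  intro σ L hL hd
  have hmono : StrictMono σ := by
    intro a a' haa'
    by_contra hlt
    have hlt' : σ a' < σ a := (not_lt.1 hlt).lt_of_ne (σ.injective.ne haa'.ne')
    exact hplanar a a' _ _ _ _ haa' hlt' (hL a) (hL a') (hd a a' haa'.ne)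
  have : hmono.orderIsoOfSurjective σ σ.surjective = OrderIso.refl _ := Subsingleton.elim _ _
  ext a
  exact congrArg Fin.val (congrFun (congrArg DFunLike.coe this) a)

/-- `w_I^{(k)}` as a determinant of single-path sums. -/
theorem chainSum_eq_det {r s : ℕ} (i₁ i₂ j₁ j₂ k : ℕ) (x : PosLabeling (Rect r s)) :
    chainSum i₁ i₂ j₁ j₂ k x = Matrix.det (Matrix.of fun a b : Fin k =>
      pathSum (rectInterval r s i₁ i₂ j₁ j₂) x.1 (i₁, j₁ + a.val) (i₂, j₂ + 1 + b.val - k)) := by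
  refine totalWeight_pathFamilies _ _ _ _ fun a a' b b' C C' ha hb h h' => ?_
  rw [isPath_iff] at h h'
  obtain ⟨-, p, q, hp, hq, hC⟩ := h
  obtain ⟨-, p', q', hp', hq', hC'⟩ := h'
  simp only [coords, Prod.mk.injEq] at hp hq hp' hq'
  refine hC.not_disjoint_of_cross hC' (Fin.ext (by lia)) (Fin.ext (by lia)) ?_ ?_
  · rw [Fin.lt_def]
    lia
  · rw [Fin.le_def]
    lia

theorem chainSumRefl_eq_det {r s : ℕ} (i₁ i₂ j₁ j₂ k : ℕ) (x : PosLabeling (Rect r s)) :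
    chainSumRefl i₁ i₂ j₁ j₂ k x = Matrix.det (Matrix.of fun a b : Fin k =>
      pathSum (rectInterval r s i₁ i₂ j₁ j₂) x.1 (i₁ + a.val, j₁) (i₂ + 1 + b.val - k, j₂)) := by
  refine totalWeight_pathFamilies _ _ _ _ fun a a' b b' C C' ha hb h h' => ?_
  rw [isPath_iff] at h h'
  obtain ⟨-, p, q, hp, hq, hC⟩ := h
  obtain ⟨-, p', q', hp', hq', hC'⟩ := h'
  simp only [coords, Prod.mk.injEq] at hp hq hp' hq'
  refine hC.not_disjoint_of_cross' hC' (Fin.ext (by lia)) (Fin.ext (by lia)) ?_ ?_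
  · rw [Fin.lt_def]
    lia
  · rw [Fin.le_def]
    lia

theorem pathSum_eq_zero {r s i₁ i₂ j₁ j₂ : ℕ} (x : Rect r s → ℝ) {a a' : ℕ} {b : ℕ × ℕ}
    (ha : i₂ < a ∨ j₂ < a') : pathSum (rectInterval r s i₁ i₂ j₁ j₂) x (a, a') b = 0 := by
  classical
  refine Finset.sum_eq_zero fun C hC => ?_
  obtain ⟨hI, p, q, hp, -, h⟩ := isPath_iff.1 (Finset.mem_filter.1 hC).2
  have := hI h.left_mem
  simp only [rectInterval, Finset.mem_filter, Finset.mem_univ, true_and, hp] at this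
  lia

/-- Between two points of an interval, all paths stay inside the interval. -/
theorem pathSum_rectInterval {r s i₁ i₂ j₁ j₂ : ℕ} (x : Rect r s → ℝ) {a a' b b' : ℕ}
    (h₁ : i₁ ≤ a) (h₂ : j₁ ≤ a') (h₃ : b ≤ i₂) (h₄ : b' ≤ j₂) :
    pathSum (rectInterval r s i₁ i₂ j₁ j₂) x (a, a') (b, b') =
      pathSum Finset.univ x (a, a') (b, b') := by
  classical
  refine Finset.sum_congr (Finset.filter_congr fun C _ => ?_) fun _ _ => rfl
  rw [isPath_iff, isPath_iff]
  refine ⟨fun h => ⟨Finset.subset_univ _, h.2⟩, fun h => ⟨fun z hz => ?_, h.2⟩⟩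
  obtain ⟨-, p, q, hp, hq, h⟩ := h
  have hz := h.mem_bounds z hz
  have e1 := Fin.le_def.1 hz.1.1
  have e2 := Fin.le_def.1 hz.1.2
  have e3 := Fin.le_def.1 hz.2.1
  have e4 := Fin.le_def.1 hz.2.2
  simp only [coords, Prod.mk.injEq] at hp hq
  rw [rectInterval, Finset.mem_filter]
  simp only [coords, Finset.mem_univ, true_and]
  lia

/-! ### Extending labelings by zero -/

/-- The extension of a labeling of the rectangle by zero to `ℕ × ℕ`; coordinates are counted
from `1`. -/
noncomputable def ext {r s : ℕ} (f : Rect r s → ℝ) (i j : ℕ) : ℝ :=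
  ∑ q : Rect r s, if coords q = (i, j) then f q else 0

theorem ext_coords {r s : ℕ} (f : Rect r s → ℝ) (p : Rect r s) :
    ext f (coords p).1 (coords p).2 = f p := by
  simp [ext, coords_injective.eq_iff]

theorem ext_eq_zero {r s : ℕ} (f : Rect r s → ℝ) {i j : ℕ}
    (h : ¬ (1 ≤ i ∧ i ≤ r ∧ 1 ≤ j ∧ j ≤ s)) : ext f i j = 0 := by
  refine Finset.sum_eq_zero fun q _ => if_neg fun e => h ?_
  simp only [coords, Prod.mk.injEq] at e
  lia

theorem exists_coords_eq {r s i j : ℕ} (h : 1 ≤ i ∧ i ≤ r ∧ 1 ≤ j ∧ j ≤ s) :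
    ∃ p : Rect r s, coords p = (i, j) :=
  ⟨(⟨i - 1, by lia⟩, ⟨j - 1, by lia⟩), by simp only [coords, Prod.mk.injEq]; lia⟩

theorem covBy_iff_coords {r s : ℕ} {p q : Rect r s} :
    q ⋖ p ↔ coords p = ((coords q).1 + 1, (coords q).2) ∨
      coords p = ((coords q).1, (coords q).2 + 1) := by
  rw [Prod.covBy_iff, Fin.covBy_iff, Fin.covBy_iff, Nat.covBy_iff_add_one_eq,
    Nat.covBy_iff_add_one_eq, Fin.ext_iff, Fin.ext_iff]
  simp only [coords, Prod.mk.injEq]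
  lia

theorem sum_lowerCovers {r s : ℕ} (f : Rect r s → ℝ) (p : Rect r s) :
    ∑ q ∈ lowerCovers p, f q =
      ext f ((coords p).1 - 1) (coords p).2 + ext f (coords p).1 ((coords p).2 - 1) := by
  rw [lowerCovers, Finset.sum_filter, ext, ext, ← Finset.sum_add_distrib]
  refine Finset.sum_congr rfl fun q _ => ?_
  have h1 : 1 ≤ (coords p).1 := by simp [coords]
  have h2 : 1 ≤ (coords p).2 := by simp [coords]
  simp only [covBy_iff_coords, Prod.ext_iff]
  split_ifs <;> first | (exfalso; lia) | simp

theorem sum_upperCovers {r s : ℕ} (f : Rect r s → ℝ) (p : Rect r s) :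
    ∑ q ∈ upperCovers p, f q =
      ext f ((coords p).1 + 1) (coords p).2 + ext f (coords p).1 ((coords p).2 + 1) := by
  rw [upperCovers, Finset.sum_filter, ext, ext, ← Finset.sum_add_distrib]
  refine Finset.sum_congr rfl fun q _ => ?_
  simp only [covBy_iff_coords, Prod.ext_iff]
  split_ifs <;> first | (exfalso; lia) | simp

theorem pathSum_univ_coords {r s : ℕ} (x : Rect r s → ℝ) (p q : Rect r s) :
    pathSum Finset.univ x (coords p) (coords q) = satChainSum x p q := by
  classical
  refine Finset.sum_congr (Finset.filter_congr fun C _ => ?_) fun _ _ => rfl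
  rw [isPath_iff]
  constructor
  · rintro ⟨-, p', q', hp, hq, h⟩
    rwa [← coords_injective hp, ← coords_injective hq]
  · exact fun h => ⟨Finset.subset_univ _, p, q, rfl, rfl, h⟩

theorem pathSum_univ_eq_zero {r s : ℕ} (x : Rect r s → ℝ) {a b : ℕ × ℕ}
    (h : ¬ ∃ p q : Rect r s, coords p = a ∧ coords q = b) : pathSum Finset.univ x a b = 0 := by
  classical
  refine Finset.sum_eq_zero fun C hC => absurd ?_ h
  obtain ⟨-, p, q, hp, hq, -⟩ := isPath_iff.1 (Finset.mem_filter.1 hC).2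
  exact ⟨p, q, hp, hq⟩

/-- Splitting off the last vertex of a path. -/
theorem pathSum_univ_eq {r s : ℕ} (x : Rect r s → ℝ) (a : ℕ × ℕ) (i j : ℕ) :
    pathSum Finset.univ x a (i, j) = ext x i j *
      (pathSum Finset.univ x a (i - 1, j) + pathSum Finset.univ x a (i, j - 1) +
        if a = (i, j) then 1 else 0) := by
  by_cases hq : 1 ≤ i ∧ i ≤ r ∧ 1 ≤ j ∧ j ≤ s
  swap
  · rw [ext_eq_zero x hq, zero_mul]
    refine pathSum_univ_eq_zero x fun ⟨p, q, hp, e⟩ => hq ?_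
    simp only [coords, Prod.mk.injEq] at e
    lia
  by_cases ha : ∃ p : Rect r s, coords p = a
  swap
  · have h0 : ∀ b, pathSum (r := r) (s := s) Finset.univ x a b = 0 := fun b =>
      pathSum_univ_eq_zero x fun ⟨p, q, hp, _⟩ => ha ⟨p, hp⟩
    have h1 : a ≠ (i, j) := fun e => ha (e ▸ exists_coords_eq hq)
    simp [h0, h1]
  obtain ⟨p, rfl⟩ := ha
  obtain ⟨q, hq⟩ := exists_coords_eq hq
  have hext : ∀ i j, pathSum Finset.univ x (coords p) (i, j) = ext (satChainSum x p) i j := by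
    intro i j
    by_cases h : 1 ≤ i ∧ i ≤ r ∧ 1 ≤ j ∧ j ≤ s
    · obtain ⟨q, hq⟩ := exists_coords_eq h
      rw [← hq, pathSum_univ_coords, ← ext_coords (satChainSum x p) q, hq]
    · rw [ext_eq_zero _ h]
      refine pathSum_univ_eq_zero x fun ⟨p, q, hp, e⟩ => h ?_
      simp only [coords, Prod.mk.injEq] at e
      lia
  rw [hext (i - 1), hext i (j - 1), ← hq, pathSum_univ_coords, satChainSum_eq, sum_lowerCovers, hq,
    ← ext_coords x q, hq]
  simp only [← hq, coords_injective.eq_iff]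

/-! ### The shift identity -/

/-- The relation between `y`, `x = φ(y)` and `x' = φ(ρ⁻¹(y))`, as functions on `ℕ × ℕ` that vanish
outside `[1, r] × [1, s]`, restricted to the points where a lower (resp. upper) cover in the second
coordinate exists. Since `0⁻¹ = 0`, covers outside the rectangle contribute nothing. -/
structure IsShiftPair (r s : ℕ) (Y X X' : ℕ → ℕ → ℝ) : Prop where
  Y_pos : ∀ i j, i < r → j < s → 0 < Y (i + 1) (j + 1)
  Y_zero : ∀ i j, ¬ (1 ≤ i ∧ i ≤ r ∧ 1 ≤ j ∧ j ≤ s) → Y i j = 0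
  X_zero : ∀ i j, ¬ (1 ≤ i ∧ i ≤ r ∧ 1 ≤ j ∧ j ≤ s) → X i j = 0
  X'_zero : ∀ i j, ¬ (1 ≤ i ∧ i ≤ r ∧ 1 ≤ j ∧ j ≤ s) → X' i j = 0
  X_mul : ∀ i j, i < r → j + 1 < s →
    X (i + 1) (j + 2) * (Y i (j + 2) + Y (i + 1) (j + 1)) = Y (i + 1) (j + 2)
  X'_mul : ∀ i j, i < r → j + 1 < s →
    X' (i + 1) (j + 1) * (Y (i + 1) (j + 1) *
      ((Y (i + 2) (j + 1))⁻¹ + (Y (i + 1) (j + 2))⁻¹)) = 1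

/-- `H a u i j` satisfies the recursion of the total weight of the paths from `(a, u)` to `(i, j)`
whose vertices are weighted by `X`. -/
def IsPathKernel (X : ℕ → ℕ → ℝ) (H : ℕ → ℕ → ℕ → ℕ → ℝ) : Prop :=
  ∀ a u i j, H a u i j =
    X i j * (H a u (i - 1) j + H a u i (j - 1) + if a = i ∧ u = j then 1 else 0)

section shift

variable {r s : ℕ} {Y X X' : ℕ → ℕ → ℝ} {H H' : ℕ → ℕ → ℕ → ℕ → ℝ}

theorem IsPathKernel.eq_zero (hH : IsPathKernel X H) {a u i j : ℕ} (h : X i j = 0) :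
    H a u i j = 0 := by
  rw [hH, h, zero_mul]

theorem IsPathKernel.eq_zero_of_lt (hH : IsPathKernel X H)
    (hX : ∀ i j, ¬ (1 ≤ i ∧ i ≤ r ∧ 1 ≤ j ∧ j ≤ s) → X i j = 0) {a u : ℕ} :
    ∀ j i, j < u → H a u i j = 0 := by
  intro j
  induction j with
  | zero => exact fun i _ => hH.eq_zero (hX _ _ (by lia))
  | succ j ihj =>
    intro i hj
    induction i with
    | zero => exact hH.eq_zero (hX _ _ (by lia))
    | succ i ihi =>
      rw [hH, Nat.add_sub_cancel, Nat.add_sub_cancel, ihi, ihj _ (by lia),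
        if_neg (by lia), add_zero, add_zero, mul_zero]

/-- The path sums from a fixed column to column `j + 1` for the labels `X`, and the path sums
between the columns one step to the left for the labels `X'`, are conjugate by unitriangular
bidiagonal matrices. -/
theorem IsShiftPair.conjugation (h : IsShiftPair r s Y X X') (hH : IsPathKernel X H)
    (hH' : IsPathKernel X' H') {a u : ℕ} (ha : a < r) :
    ∀ j b, j + 1 ≤ s → b ≤ r →
      H' (a + 1) (u + 1) b j - Y a (u + 1) / Y (a + 1) (u + 1) * H' a (u + 1) b j =
        H (a + 1) (u + 2) b (j + 1) -
          H (a + 1) (u + 2) (b + 1) (j + 1) * (Y b (j + 1) / Y (b + 1) (j + 1)) := by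
  intro j
  induction j with
  | zero =>
    intro b _ _
    rw [hH.eq_zero_of_lt h.X_zero _ _ (by lia), hH.eq_zero_of_lt h.X_zero _ _ (by lia),
      hH'.eq_zero (h.X'_zero _ _ (by lia)), hH'.eq_zero (h.X'_zero _ _ (by lia))]
    ring
  | succ j ihj =>
    intro b hj hb
    induction b with
    | zero =>
      rw [hH.eq_zero (h.X_zero 0 _ (by lia)), hH'.eq_zero (h.X'_zero 0 _ (by lia)),
        hH'.eq_zero (h.X'_zero 0 _ (by lia)), h.Y_zero 0 _ (by lia)]
      ring
    | succ b ihb =>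
      have e1 := ihb (by lia)
      have e2 := ihj (b + 1) (by lia) hb
      have hm := h.Y_pos b j (by lia) (by lia)
      have hp := h.Y_pos b (j + 1) (by lia) (by lia)
      have hX := h.X_mul b j (by lia) (by lia)
      have hX' := h.X'_mul b j (by lia) (by lia)
      have f1 := hH (a + 1) (u + 2) (b + 1) (j + 2)
      have f2 := hH (a + 1) (u + 2) (b + 2) (j + 2)
      have g1 := hH' (a + 1) (u + 1) (b + 1) (j + 1)
      have g2 := hH' a (u + 1) (b + 1) (j + 1)
      simp only [Nat.add_sub_cancel, Nat.add_right_cancel_iff, show b + 2 - 1 = b + 1 from rfl,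
        show j + 2 - 1 = j + 1 from rfl, show ∀ n : ℕ, n + 1 + 1 = n + 2 from fun _ => rfl,
        show a + 1 = b + 2 ↔ a = b + 1 from by lia] at f1 f2 g1 g2 e1 e2 hp ⊢
      -- The source terms of the two recursions match.
      have hsrc : Y a (u + 1) / Y (a + 1) (u + 1) * (if a = b + 1 ∧ u = j then (1 : ℝ) else 0) =
          Y (b + 1) (j + 1) / Y (b + 2) (j + 1) * (if a = b + 1 ∧ u = j then 1 else 0) := by
        split_ifs with hs
        · rw [hs.1, hs.2]
        · ring
      have hsrc0 : ¬ b + 2 ≤ r → (if a = b + 1 ∧ u = j then (1 : ℝ) else 0) = 0 := fun hbr =>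
        if_neg (by lia)
      have f1' : H (a + 1) (u + 2) b (j + 2) + H (a + 1) (u + 2) (b + 1) (j + 1) +
          (if a = b ∧ u = j then 1 else 0) =
          H (a + 1) (u + 2) (b + 1) (j + 2) * (Y b (j + 2) + Y (b + 1) (j + 1)) /
            Y (b + 1) (j + 2) := by
        rw [eq_div_iff hp.ne', f1, ← hX]
        ring
      rw [g1, g2]
      generalize (if a = b ∧ u = j then (1 : ℝ) else 0) = δ₁ at *
      generalize (if a = b + 1 ∧ u = j then (1 : ℝ) else 0) = δ₀ at *
      generalize Y a (u + 1) / Y (a + 1) (u + 1) = c at *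
      -- Dividing by `X' (b + 1) (j + 1)`, only the recursion for `H` is left to be used.
      suffices hs : H (a + 1) (u + 2) b (j + 2) + H (a + 1) (u + 2) (b + 1) (j + 1) + δ₁ -
          H (a + 1) (u + 2) (b + 1) (j + 2) * (Y b (j + 2) / Y (b + 1) (j + 2)) -
          (H (a + 1) (u + 2) (b + 2) (j + 1) + δ₀) * (Y (b + 1) (j + 1) / Y (b + 2) (j + 1)) =
          (H (a + 1) (u + 2) (b + 1) (j + 2) - H (a + 1) (u + 2) (b + 2) (j + 2) *
            (Y (b + 1) (j + 2) / Y (b + 2) (j + 2))) *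
          (Y (b + 1) (j + 1) * ((Y (b + 2) (j + 1))⁻¹ + (Y (b + 1) (j + 2))⁻¹)) by
        linear_combination X' (b + 1) (j + 1) * (e1 + e2 - hsrc + hs) +
          (H (a + 1) (u + 2) (b + 1) (j + 2) - H (a + 1) (u + 2) (b + 2) (j + 2) *
            (Y (b + 1) (j + 2) / Y (b + 2) (j + 2))) * hX'
      rw [f1']
      by_cases hbr : b + 2 ≤ r
      · have hn := h.Y_pos (b + 1) j (by lia) (by lia)
        have ht := h.Y_pos (b + 1) (j + 1) (by lia) (by lia)
        have hX2 := h.X_mul (b + 1) j (by lia) (by lia)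
        simp only [show ∀ n : ℕ, n + 1 + 1 = n + 2 from fun _ => rfl] at hn ht hX2
        have f2' : H (a + 1) (u + 2) (b + 2) (j + 1) + δ₀ =
            H (a + 1) (u + 2) (b + 2) (j + 2) * (Y (b + 1) (j + 2) + Y (b + 2) (j + 1)) /
              Y (b + 2) (j + 2) - H (a + 1) (u + 2) (b + 1) (j + 2) := by
          rw [eq_sub_iff_add_eq, eq_div_iff ht.ne', f2, ← hX2]
          ring
        rw [f2']
        field_simp
        ring
      · -- Here `b + 1 = r`, and all the terms from row `b + 2` vanish.
        rw [hsrc0 hbr, h.Y_zero (b + 2) _ (by lia), hH.eq_zero (h.X_zero (b + 2) (j + 1) (by lia)),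
          hH.eq_zero (h.X_zero (b + 2) (j + 2) (by lia))]
        field_simp
        ring

/-- The path sums from the first to the last row are invariant under the shift: the correction terms
of `IsShiftPair.conjugation` involve the rows `0` and `r + 1`, where everything vanishes. -/
theorem IsShiftPair.corner_eq (h : IsShiftPair r s Y X X') (hH : IsPathKernel X H)
    (hH' : IsPathKernel X' H') {u d : ℕ} (hd : d + 1 ≤ s) :
    H 1 (u + 2) r (d + 1) = H' 1 (u + 1) r d := by
  rcases Nat.eq_zero_or_pos r with rfl | hr
  · rw [hH.eq_zero (h.X_zero 0 _ (by lia)), hH'.eq_zero (h.X'_zero 0 _ (by lia))]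
  · have := h.conjugation hH hH' (u := u) hr d r hd le_rfl
    rw [hH.eq_zero (h.X_zero (r + 1) _ (by lia)), h.Y_zero 0 _ (by lia)] at this
    simpa using this.symm

/-- The minor of the first `k` rows and the last `k` columns is invariant under the shift, because
the correction terms of `IsShiftPair.conjugation` are unitriangular row and column operations. -/
theorem IsShiftPair.det_eq (h : IsShiftPair r s Y X X') (hH : IsPathKernel X H)
    (hH' : IsPathKernel X' H') {u d k : ℕ} (hd : d + 1 ≤ s) (hk : k ≤ r) :
    Matrix.det (Matrix.of fun a b : Fin k => H (1 + a) (u + 2) (r + 1 + b - k) (d + 1)) =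
      Matrix.det (Matrix.of fun a b : Fin k => H' (1 + a) (u + 1) (r + 1 + b - k) d) := by
  cases k with
  | zero => simp
  | succ n =>
    let Z : Matrix (Fin (n + 1)) (Fin (n + 1)) ℝ := Matrix.of fun a b =>
      H' (a + 1) (u + 1) (r + 1 + b - (n + 1)) d -
        Y a (u + 1) / Y (a + 1) (u + 1) * H' a (u + 1) (r + 1 + b - (n + 1)) d
    have hZ : ∀ a b : Fin (n + 1), Z a b =
        H (a + 1) (u + 2) (r + 1 + b - (n + 1)) (d + 1) -
          H (a + 1) (u + 2) (r + 1 + b - (n + 1) + 1) (d + 1) *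
            (Y (r + 1 + b - (n + 1)) (d + 1) / Y (r + 1 + b - (n + 1) + 1) (d + 1)) :=
      fun a b => h.conjugation hH hH' (by lia) d _ hd (by lia)
    trans Z.det
    · -- Column operations from right to left: reverse the order of rows and columns.
      rw [← Matrix.det_submatrix_equiv_self Fin.revPerm, ← Matrix.det_submatrix_equiv_self
        Fin.revPerm Z]
      refine Matrix.det_eq_of_forall_col_eq_smul_add_pred
        (fun b : Fin n => Y (r + 1 + (n - (b + 1)) - (n + 1)) (d + 1) /
          Y (r + 1 + (n - b) - (n + 1)) (d + 1)) ?_ ?_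
      · intro a
        simp only [Matrix.submatrix_apply, Matrix.of_apply, hZ, Fin.revPerm_apply, Fin.rev_zero,
          Fin.val_last]
        rw [hH.eq_zero (h.X_zero (r + 1 + n - (n + 1) + 1) _ (by lia)), zero_mul, sub_zero,
          add_comm 1]
      · intro a b
        simp only [Matrix.submatrix_apply, Matrix.of_apply, hZ, Fin.revPerm_apply, Fin.val_rev,
          Fin.val_succ, Fin.val_castSucc]
        rw [show n + 1 - (b + 1 + 1) = n - (b + 1) by lia, show n + 1 - (b + 1) = n - b by lia,
          show r + 1 + (n - (b + 1)) - (n + 1) + 1 = r + 1 + (n - b) - (n + 1) by lia, add_comm 1]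
        ring
    · symm
      refine Matrix.det_eq_of_forall_row_eq_smul_add_pred
        (fun a : Fin n => Y (a + 1) (u + 1) / Y (a + 1 + 1) (u + 1)) ?_ ?_
      · intro b
        simp [Z, h.Y_zero 0 _ (by lia)]
      · intro a b
        simp only [Z, Matrix.of_apply, Fin.val_succ, Fin.val_castSucc, add_comm 1]
        ring

end shift

/-! ### Rowmotion -/

/-- Toggling along a list that is compatible with the order and closed upwards, starting from its
last element. -/
theorem prod_toggle_apply {P : Type*} [Fintype P] [PartialOrder P] (l : List P)
    (z : PosLabeling P) (hnd : l.Nodup) (hord : l.Pairwise fun a b => ¬ b < a)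
    (hup : ∀ p ∈ l, ∀ q, p < q → q ∈ l) :
    (∀ p ∉ l, ((l.map toggle).prod z).1 p = z.1 p) ∧
      ∀ p ∈ l, ((l.map toggle).prod z).1 p =
        parSumOrOne (upperCovers p) ((l.map toggle).prod z).1 *
          sumOrOne (lowerCovers p) z.1 * (1 / z.1 p) := by
  classical
  induction l with
  | nil => simp
  | cons a t ih =>
    rw [List.nodup_cons] at hnd
    rw [List.pairwise_cons] at hord
    obtain ⟨ih1, ih2⟩ := ih hnd.2 hord.2 fun p hp q hpq =>
      (List.mem_cons.1 (hup p (List.mem_cons_of_mem _ hp) q hpq)).resolve_left fun e =>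
        hord.1 p hp (e ▸ hpq)
    rw [List.map_cons, List.prod_cons, Equiv.Perm.mul_apply]
    generalize (t.map toggle).prod z = w at *
    have hne : ∀ p, p ≠ a → (toggle a w).1 p = w.1 p := fun p hp => by
      simp [toggle, toggleFun, Function.update_of_ne hp]
    have ha : (toggle a w).1 a = toggleValue a w.1 := by simp [toggle, toggleFun]
    refine ⟨fun p hp => ?_, fun p hp => ?_⟩
    · rw [List.mem_cons, not_or] at hp
      rw [hne p hp.1, ih1 p hp.2]
    · rcases List.mem_cons.1 hp with rfl | hp'
      · rw [ha, toggleValue, ih1 p hnd.1]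
        congr 2
        · refine parSumOrOne_congr _ _ _ fun q hq => (hne q ?_).symm
          simp only [upperCovers, Finset.mem_filter] at hq
          exact hq.2.lt.ne'
        · refine sumOrOne_congr _ _ _ fun q hq => ih1 q fun hqt => ?_
          simp only [lowerCovers, Finset.mem_filter] at hq
          exact hord.1 q hqt hq.2.lt
      · rw [hne p fun e => hnd.1 (e ▸ hp'), ih2 p hp']
        congr 2
        refine parSumOrOne_congr _ _ _ fun q hq => (hne q fun e => ?_).symm
        simp only [upperCovers, Finset.mem_filter] at hq
        exact hord.1 p hp' (e ▸ hq.2.lt)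

/-- The implicit local description of rowmotion; it does not depend on the linear extension. -/
theorem rowmotion_apply {P : Type*} [Fintype P] [PartialOrder P]
    {ℓ : P ≃ Fin (Fintype.card P)} (hℓ : IsLinearExtension ℓ) (z : PosLabeling P) (p : P) :
    (rowmotion ℓ z).1 p = parSumOrOne (upperCovers p) (rowmotion ℓ z).1 *
      sumOrOne (lowerCovers p) z.1 * (1 / z.1 p) := by
  have hmem : ∀ p, p ∈ (List.finRange (Fintype.card P)).map ℓ.symm := fun p =>
    List.mem_map.2 ⟨ℓ p, List.mem_finRange _, ℓ.symm_apply_apply p⟩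
  have h := (prod_toggle_apply ((List.finRange (Fintype.card P)).map ℓ.symm) z
    ((List.nodup_finRange _).map ℓ.symm.injective) ?_ fun _ _ q _ => hmem q).2 p (hmem p)
  · rw [List.map_map] at h
    exact h
  · rw [List.pairwise_map]
    refine (List.pairwise_lt_finRange _).imp fun {a b} hab hlt => ?_
    have := hℓ _ _ hlt.le
    rw [ℓ.apply_symm_apply, ℓ.apply_symm_apply] at this
    exact this.not_gt hab

theorem transfer_rowmotion_symm {P : Type*} [Fintype P] [PartialOrder P]
    {ℓ : P ≃ Fin (Fintype.card P)} (hℓ : IsLinearExtension ℓ) (y : PosLabeling P) (p : P) :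
    (transfer ((rowmotion ℓ).symm y)).1 p = parSumOrOne (upperCovers p) y.1 / y.1 p := by
  have h := rowmotion_apply hℓ ((rowmotion ℓ).symm y) p
  rw [Equiv.apply_symm_apply] at h
  generalize (rowmotion ℓ).symm y = z at h ⊢
  have h1 := sumOrOne_pos (lowerCovers p) z.1 fun q _ => z.2 q
  have h2 := parSumOrOne_pos (upperCovers p) y.1 fun q _ => y.2 q
  have h3 := z.2 p
  change z.1 p / sumOrOne (lowerCovers p) z.1 = _
  rw [h]
  field_simp

/-! ### Labelings of the rectangle -/

section rect

variable {r s : ℕ}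

theorem ext_inv (f : Rect r s → ℝ) (i j : ℕ) : ext (fun q => (f q)⁻¹) i j = (ext f i j)⁻¹ := by
  by_cases h : 1 ≤ i ∧ i ≤ r ∧ 1 ≤ j ∧ j ≤ s
  · obtain ⟨p, hp⟩ := exists_coords_eq h
    have e1 := ext_coords f p
    have e2 := ext_coords (fun q => (f q)⁻¹) p
    rw [hp] at e1 e2
    rw [e1, e2]
  · rw [ext_eq_zero _ h, ext_eq_zero _ h, inv_zero]

theorem ext_pos (y : PosLabeling (Rect r s)) {i j : ℕ} (hi : i < r) (hj : j < s) :
    0 < ext y.1 (i + 1) (j + 1) := by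
  obtain ⟨p, hp⟩ := exists_coords_eq (r := r) (s := s) (i := i + 1) (j := j + 1) (by lia)
  have := ext_coords y.1 p
  rw [hp] at this
  exact this ▸ y.2 p

theorem ext_mul_lower {x y : PosLabeling (Rect r s)}
    (hx : ∀ p, x.1 p = y.1 p / sumOrOne (lowerCovers p) y.1) {i j : ℕ}
    (h : 1 ≤ i ∧ i ≤ r ∧ 1 ≤ j ∧ j ≤ s) (hij : 1 < i ∨ 1 < j) :
    ext x.1 i j * (ext y.1 (i - 1) j + ext y.1 i (j - 1)) = ext y.1 i j := by
  obtain ⟨p, hp⟩ := exists_coords_eq h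
  have hne : (lowerCovers p).Nonempty := by
    have : ∃ q : Rect r s, q ⋖ p := by
      rcases hij with hi | hj
      · obtain ⟨q, hq⟩ := exists_coords_eq (r := r) (s := s) (i := i - 1) (j := j) (by lia)
        refine ⟨q, covBy_iff_coords.2 (Or.inl ?_)⟩
        rw [hp, hq, Nat.sub_add_cancel h.1]
      · obtain ⟨q, hq⟩ := exists_coords_eq (r := r) (s := s) (i := i) (j := j - 1) (by lia)
        refine ⟨q, covBy_iff_coords.2 (Or.inr ?_)⟩
        rw [hp, hq, Nat.sub_add_cancel h.2.2.1]
    obtain ⟨q, hq⟩ := this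
    exact ⟨q, by simp [lowerCovers, hq]⟩
  have e := hx p
  have hpos := sumOrOne_pos (lowerCovers p) y.1 fun q _ => y.2 q
  rw [eq_div_iff hpos.ne', sumOrOne, if_pos hne, sum_lowerCovers, ← ext_coords x.1 p,
    ← ext_coords y.1 p, hp] at e
  exact e

theorem ext_mul_upper {x' y : PosLabeling (Rect r s)}
    (hx' : ∀ p, x'.1 p = parSumOrOne (upperCovers p) y.1 / y.1 p) {i j : ℕ}
    (h : 1 ≤ i ∧ i ≤ r ∧ 1 ≤ j ∧ j ≤ s) (hij : i < r ∨ j < s) :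
    ext x'.1 i j * (ext y.1 i j * ((ext y.1 (i + 1) j)⁻¹ + (ext y.1 i (j + 1))⁻¹)) = 1 := by
  obtain ⟨p, hp⟩ := exists_coords_eq h
  have hne : (upperCovers p).Nonempty := by
    have : ∃ q : Rect r s, p ⋖ q := by
      rcases hij with hi | hj
      · obtain ⟨q, hq⟩ := exists_coords_eq (r := r) (s := s) (i := i + 1) (j := j) (by lia)
        exact ⟨q, covBy_iff_coords.2 (Or.inl (by rw [hp, hq]))⟩
      · obtain ⟨q, hq⟩ := exists_coords_eq (r := r) (s := s) (i := i) (j := j + 1) (by lia)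
        exact ⟨q, covBy_iff_coords.2 (Or.inr (by rw [hp, hq]))⟩
    obtain ⟨q, hq⟩ := this
    exact ⟨q, by simp [upperCovers, hq]⟩
  have e := hx' p
  have hsum : ∑ q ∈ upperCovers p, (y.1 q)⁻¹ = (ext y.1 (i + 1) j)⁻¹ + (ext y.1 i (j + 1))⁻¹ := by
    rw [sum_upperCovers (fun q => (y.1 q)⁻¹) p, hp, ext_inv, ext_inv]
  have hpos := parSumOrOne_pos (upperCovers p) y.1 fun q _ => y.2 q
  rw [parSumOrOne, if_pos hne, hsum] at e hpos
  have e1 := ext_coords x'.1 p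
  have e2 := ext_coords y.1 p
  rw [hp] at e1 e2
  rw [e1, e2, e]
  have hy := y.2 p
  have hpos' := inv_pos.1 hpos
  generalize (ext y.1 (i + 1) j)⁻¹ + (ext y.1 i (j + 1))⁻¹ = S at *
  field_simp

variable {x x' y : PosLabeling (Rect r s)}

theorem isShiftPair_ext (hx : ∀ p, x.1 p = y.1 p / sumOrOne (lowerCovers p) y.1)
    (hx' : ∀ p, x'.1 p = parSumOrOne (upperCovers p) y.1 / y.1 p) :
    IsShiftPair r s (ext y.1) (ext x.1) (ext x'.1) where
  Y_pos _ _ hi hj := ext_pos y hi hj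
  Y_zero _ _ h := ext_eq_zero _ h
  X_zero _ _ h := ext_eq_zero _ h
  X'_zero _ _ h := ext_eq_zero _ h
  X_mul i j hi hj := ext_mul_lower hx (i := i + 1) (j := j + 2) (by lia) (by lia)
  X'_mul i j hi hj := ext_mul_upper hx' (i := i + 1) (j := j + 1) (by lia) (by lia)

/-- The mirror image of `isShiftPair_ext` under exchanging the two coordinates. -/
theorem isShiftPair_ext_swap (hx : ∀ p, x.1 p = y.1 p / sumOrOne (lowerCovers p) y.1)
    (hx' : ∀ p, x'.1 p = parSumOrOne (upperCovers p) y.1 / y.1 p) :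
    IsShiftPair s r (fun i j => ext y.1 j i) (fun i j => ext x.1 j i)
      (fun i j => ext x'.1 j i) where
  Y_pos _ _ hi hj := ext_pos y hj hi
  Y_zero _ _ h := ext_eq_zero _ (by lia)
  X_zero _ _ h := ext_eq_zero _ (by lia)
  X'_zero _ _ h := ext_eq_zero _ (by lia)
  X_mul i j hi hj := by
    rw [add_comm (ext y.1 (j + 2) i)]
    exact ext_mul_lower hx (i := j + 2) (j := i + 1) (by lia) (by lia)
  X'_mul i j hi hj := by
    rw [add_comm (ext y.1 (j + 1) (i + 2))⁻¹]
    exact ext_mul_upper hx' (i := j + 1) (j := i + 1) (by lia) (by lia)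

theorem isPathKernel_pathSum (x : Rect r s → ℝ) :
    IsPathKernel (ext x) fun a u i j => pathSum Finset.univ x (a, u) (i, j) := fun a u i j => by
  simp only [pathSum_univ_eq x (a, u) i j, Prod.mk.injEq]

theorem isPathKernel_pathSum_swap (x : Rect r s → ℝ) :
    IsPathKernel (fun i j => ext x j i) fun a u i j => pathSum Finset.univ x (u, a) (j, i) :=
  fun a u i j => by
    simp only [pathSum_univ_eq x (u, a) j i, Prod.mk.injEq, and_comm (a := a = i)]
    rw [add_comm (pathSum Finset.univ x (u, a) (j - 1, i))]

theorem chainSum_shift (hx : ∀ p, x.1 p = y.1 p / sumOrOne (lowerCovers p) y.1)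
    (hx' : ∀ p, x'.1 p = parSumOrOne (upperCovers p) y.1 / y.1 p)
    {u v : ℕ} (hu : 1 < u) (huv : u ≤ v) (hv : v ≤ s) (k : ℕ) :
    chainSum 1 r u v k x = chainSum 1 r (u - 1) (v - 1) k x' := by
  rw [chainSum_eq_det, chainSum_eq_det]
  by_cases hk : k ≤ v + 1 - u
  · congr 2
    ext a b
    rw [pathSum_rectInterval, pathSum_rectInterval]
    have := (isShiftPair_ext hx hx').corner_eq (isPathKernel_pathSum x.1)
      (isPathKernel_pathSum x'.1) (u := u - 2 + a) (d := v + b - k) (by lia)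
    · convert this using 3 <;> lia
    all_goals lia
  · -- The last source lies outside the interval, so its row of either determinant vanishes.
    refine Eq.trans (b := (0 : ℝ)) ?_ (Eq.symm ?_) <;>
      exact Matrix.det_eq_zero_of_row_eq_zero ⟨k - 1, by lia⟩ fun b =>
        pathSum_eq_zero _ (by dsimp only; lia)

theorem chainSumRefl_shift (hx : ∀ p, x.1 p = y.1 p / sumOrOne (lowerCovers p) y.1)
    (hx' : ∀ p, x'.1 p = parSumOrOne (upperCovers p) y.1 / y.1 p)
    {u v : ℕ} (hu : 1 < u) (huv : u ≤ v) (hv : v ≤ r) (k : ℕ) :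
    chainSumRefl u v 1 s k x = chainSumRefl (u - 1) (v - 1) 1 s k x' := by
  rw [chainSumRefl_eq_det, chainSumRefl_eq_det]
  by_cases hk : k ≤ v + 1 - u
  · congr 2
    ext a b
    rw [pathSum_rectInterval, pathSum_rectInterval]
    have := (isShiftPair_ext_swap hx hx').corner_eq (isPathKernel_pathSum_swap x.1)
      (isPathKernel_pathSum_swap x'.1) (u := u - 2 + a) (d := v + b - k) (by lia)
    · convert this using 3 <;> lia
    all_goals lia
  · -- The last source lies outside the interval, so its row of either determinant vanishes.
    refine Eq.trans (b := (0 : ℝ)) ?_ (Eq.symm ?_) <;>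
      exact Matrix.det_eq_zero_of_row_eq_zero ⟨k - 1, by lia⟩ fun b =>
        pathSum_eq_zero _ (by dsimp only; lia)

theorem chainSum_shift_rows (hx : ∀ p, x.1 p = y.1 p / sumOrOne (lowerCovers p) y.1)
    (hx' : ∀ p, x'.1 p = parSumOrOne (upperCovers p) y.1 / y.1 p)
    {u v : ℕ} (hu : 1 < u) (huv : u ≤ v) (hv : v ≤ r) (k : ℕ) :
    chainSum u v 1 s k x = chainSum (u - 1) (v - 1) 1 s k x' := by
  rw [chainSum_eq_det, chainSum_eq_det]
  by_cases hk : k ≤ s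
  · have := (isShiftPair_ext_swap hx hx').det_eq (isPathKernel_pathSum_swap x.1)
      (isPathKernel_pathSum_swap x'.1) (u := u - 2) (d := v - 1) (k := k) (by lia) hk
    rw [show u - 2 + 2 = u by lia, show u - 2 + 1 = u - 1 by lia,
      show v - 1 + 1 = v by lia] at this
    refine Eq.trans ?_ (this.trans ?_)
    · congr 2
      ext a b
      exact pathSum_rectInterval _ le_rfl (by lia) le_rfl (by lia)
    · congr 2
      ext a b
      exact (pathSum_rectInterval _ le_rfl (by lia) le_rfl (by lia)).symm
  · -- The last source lies outside the interval, so its row of either determinant vanishes.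
    refine Eq.trans (b := (0 : ℝ)) ?_ (Eq.symm ?_) <;>
      exact Matrix.det_eq_zero_of_row_eq_zero ⟨k - 1, by lia⟩ fun b =>
        pathSum_eq_zero _ (by dsimp only; lia)

end rect

end ChainShift

theorem mainTheorem2 (r s : ℕ)
    (ℓ : ChainShift.Rect r s ≃ Fin (Fintype.card (ChainShift.Rect r s)))
    (hℓ : ChainShift.IsLinearExtension ℓ)
    (x : ChainShift.PosLabeling (ChainShift.Rect r s)) :
    (∀ u v : ℕ, 1 < u → u ≤ v → v ≤ s → ∀ k : ℕ,
      ChainShift.chainSum 1 r u v k x =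
        ChainShift.chainSum 1 r (u - 1) (v - 1) k
          (ChainShift.transfer
            ((ChainShift.rowmotion ℓ).symm (ChainShift.transfer.symm x)))) ∧
    (∀ u v : ℕ, 1 < u → u ≤ v → v ≤ r → ∀ k : ℕ,
      ChainShift.chainSumRefl u v 1 s k x =
          ChainShift.chainSumRefl (u - 1) (v - 1) 1 s k
            (ChainShift.transfer
              ((ChainShift.rowmotion ℓ).symm (ChainShift.transfer.symm x))) ∧
        ChainShift.chainSum u v 1 s k x =
          ChainShift.chainSum (u - 1) (v - 1) 1 s k
            (ChainShift.transfer
              ((ChainShift.rowmotion ℓ).symm (ChainShift.transfer.symm x)))) := by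
  obtain ⟨y, rfl⟩ := ChainShift.transfer.surjective x
  rw [Equiv.symm_apply_apply]
  have hx : ∀ p, (ChainShift.transfer y).1 p =
      y.1 p / ChainShift.sumOrOne (ChainShift.lowerCovers p) y.1 := fun _ => rfl
  have hx' := ChainShift.transfer_rowmotion_symm hℓ y
  exact ⟨fun u v hu huv hv k => ChainShift.chainSum_shift hx hx' hu huv hv k,
    fun u v hu huv hv k => ⟨ChainShift.chainSumRefl_shift hx hx' hu huv hv k,
      ChainShift.chainSum_shift_rows hx hx' hu huv hv k⟩⟩
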